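/- Throughout, $\log$ is the logarithm to base $2$ and $\log^{(2)}=\log\circ\log$. For a subset $\mathcal K$ of a metric space $(\mathcal X,d)$ and $\varepsilon>0$, let $N(\varepsilon;\mathcal K,d)$ be the least cardinality of a finite set $\{x_1,\dots,x_N\}\subseteq\mathcal X$ such that every $x\in\mathcal K$ satisfies $d(x,x_i)\le\varepsilon$ for some $i$, and let $H(\varepsilon;\mathcal K,d)=\log N(\varepsilon;\mathcal K,d)$ be the metric entropy of $\mathcal K$. For $\rho>0$ write $D(0;\rho)=\{z\in\mathbb C: |z|<\rho\}$. Theorem. Let $r,r',M$ be positive real numbers with $r<r'$. Let $\mathcal A(r';M)$ be the class of functions $f$ that are analytic on $D(0;r')$ and satisfy $\sup_{z\in D(0;r')}|f(z)|\le M$, equipped with the metric $d_r(f_1,f_2)=\sup_{z\in D(0;r)}|f_1(z)-f_2(z)|$, and let $\mathcal X$ be any metric space that contains $(\mathcal A(r';M),d_r)$ isometrically (for instance $\mathcal A(r';M)$ itself), from which the centers of the coverings are taken. Then $N(\varepsilon;\mathcal A(r';M),d_r)$ is finite for every $\varepsilon>0$, and there is a function $\gamma$ with $|\gamma(\varepsilon)|\le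 1$ for all $\varepsilon>0$ such that, as $\varepsilon\to0^+$, $$H\left(\varepsilon;\mathcal A(r';M),d_r\right)=\frac{\log^2(\varepsilon^{-1})}{\log(r'/r)}+\frac{\log(\varepsilon^{-1})}{\log(r'/r)}\,\log^{(2)}(\varepsilon^{-1})\,\bigl(\gamma(\varepsilon)+o(1)\bigr).$$ -/

import Mathlib

open Set Filter Topology
open scoped NNReal ENNReal

/-- `N(ε; K, d)`: the least cardinality of a set `{x₁, …, x_N} ⊆ X` such that every point of `K`
is within distance `≤ ε` of some `xᵢ`; it is `⊤` if there is no finite such set. -/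
noncomputable def coveringNum {X : Type*} [PseudoMetricSpace X] (ε : ℝ) (K : Set X) : ℕ∞ :=
  Metric.externalCoveringNumber ε.toNNReal K

/-- `H(ε; K, d) = log₂ N(ε; K, d)`, meaningful when the covering number is finite. -/
noncomputable def metricEntropy {X : Type*} [PseudoMetricSpace X] (ε : ℝ) (K : Set X) : ℝ :=
  Real.logb 2 ((coveringNum ε K).toNat : ℝ)

/-- The class `𝒜(r'; M)` of functions analytic on the open disk `D(0; r')` and bounded there by
`M`. The values off the disk are unconstrained and play no role in `diskDist r` for `r ≤ r'`. -/
def analyticBounded (r' M : ℝ) : Set (ℂ → ℂ) :=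
  {f | AnalyticOnNhd ℂ f (Metric.ball 0 r') ∧ ∀ z ∈ Metric.ball (0 : ℂ) r', ‖f z‖ ≤ M}

/-- The metric `d_r(f, g) = sup_{z ∈ D(0; r)} |f z - g z|`. -/
noncomputable def diskDist (r : ℝ) (f g : ℂ → ℂ) : ℝ :=
  ⨆ z : Metric.ball (0 : ℂ) r, ‖f z - g z‖

/-! Put L = log ε⁻¹ and λ = log(r'/r). Up to errors of order ε, a function of the class is
determined on D(0; r) by its first n ≈ L/λ Taylor coefficients, since the tail of its series is
O((r/r')^n). Rescaled to radius r, these coefficients form a point of a complex ellipsoid with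
semi-axes M(r/r')^k, k < n, by Bessel's inequality on D(0; r'). Its real volume carries the factor
(r/r')^(n(n-1)). Comparing it with balls of radius ε in real dimension 2n gives the logarithm 2nL -
λn² + O(n log n), and the quadratic has its maximum L²/λ at n = L/λ.

For the upper bound (`coveringNum_le`), a maximal separated set of coefficient vectors is a
covering, and its size is bounded by the volume of a slightly enlarged ellipsoid. For the lower
bound (`le_coveringNum`), the polynomials with coefficients in a smaller ellipsoid belong to the
class, and the sup norm dominates the ℓ² norm of the coefficients, so a covering of the class gives
one of that ellipsoid by Euclidean balls.

Each direction loses a factor √n, from Cauchy–Schwarz between ℓ¹ and ℓ². Raised to the power 2n it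
costs n log n ~ (L/λ) log L, with constant 1 on either side; this is the interval [-1, 1] for γ. -/

/-! ### Volumes of complex ellipsoids, packing and covering -/

/-- The diagonal operator on `ℂⁿ` with real entries `d`. -/
noncomputable def diagMap {n : ℕ} (d : Fin n → ℝ) :
    EuclideanSpace ℂ (Fin n) →ₗ[ℂ] EuclideanSpace ℂ (Fin n) :=
  Matrix.toLin (PiLp.basisFun 2 ℂ (Fin n)) (PiLp.basisFun 2 ℂ (Fin n))
    (Matrix.diagonal fun k => (d k : ℂ))

theorem diagMap_apply {n : ℕ} (d : Fin n → ℝ) (v : EuclideanSpace ℂ (Fin n)) (k : Fin n) :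
    diagMap d v k = d k * v k := by
  simp [diagMap, Matrix.toLin_apply, Matrix.mulVec_diagonal, PiLp.basisFun_apply,
    Pi.single_apply, Finset.sum_apply]

/-- The real determinant of a complex linear map is the squared modulus of its complex determinant;
this square later produces the exponent n(n-1). -/
theorem det_diagMap {n : ℕ} (d : Fin n → ℝ) :
    LinearMap.det ((diagMap d).restrictScalars ℝ) = (∏ k, d k) ^ 2 := by
  rw [LinearMap.det_restrictScalars, diagMap, LinearMap.det_toLin, Matrix.det_diagonal,
    Algebra.norm_complex_apply, ← Complex.ofReal_prod, Complex.normSq_ofReal, sq]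

theorem finrank_real_euclideanSpace_complex (n : ℕ) :
    Module.finrank ℝ (EuclideanSpace ℂ (Fin n)) = 2 * n := by
  rw [← Module.finrank_mul_finrank ℝ ℂ, Complex.finrank_real_complex]
  simp

open MeasureTheory in
theorem addHaar_real_diagMap_closedBall {n : ℕ} (d : Fin n → ℝ) {R : ℝ} (hR : 0 ≤ R)
    (μ : Measure (EuclideanSpace ℂ (Fin n))) [μ.IsAddHaarMeasure] :
    μ.real (diagMap d '' Metric.closedBall 0 R) =
      (∏ k, d k) ^ 2 * (R ^ (2 * n) * μ.real (Metric.ball 0 1)) := by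
  have h := Measure.addHaar_image_linearMap μ ((diagMap d).restrictScalars ℝ)
    (Metric.closedBall 0 R)
  rw [det_diagMap, abs_of_nonneg (sq_nonneg _)] at h
  rw [← finrank_real_euclideanSpace_complex, ← Measure.addHaar_real_closedBall μ 0 hR]
  simp only [Measure.real]
  rw [← ENNReal.toReal_ofReal (sq_nonneg (∏ k, d k)), ← ENNReal.toReal_mul, ← h]
  rfl

theorem norm_le_of_le_diagMap {n : ℕ} {d : Fin n → ℝ} {δ : ℝ} (hδ : 0 < δ) (hd : ∀ k, δ ≤ d k)
    (v : EuclideanSpace ℂ (Fin n)) : δ * ‖v‖ ≤ ‖diagMap d v‖ := by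
  rw [← abs_of_pos hδ, ← Real.norm_eq_abs, ← norm_smul, EuclideanSpace.norm_eq,
    EuclideanSpace.norm_eq]
  gcongr with k
  rw [diagMap_apply, PiLp.smul_apply, norm_smul, norm_mul, Complex.norm_real, Real.norm_eq_abs,
    Real.norm_eq_abs, abs_of_pos hδ, abs_of_pos (hδ.trans_le (hd k))]
  gcongr
  exact hd k

theorem exists_diagMap_eq {n : ℕ} {d : Fin n → ℝ} (hd : ∀ k, 0 < d k)
    (w : EuclideanSpace ℂ (Fin n)) : ∃ v, diagMap d v = w := by
  refine ⟨WithLp.toLp 2 fun k => (d k : ℂ)⁻¹ * w k, ?_⟩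
  ext k
  have : (d k : ℂ) ≠ 0 := by exact_mod_cast (hd k).ne'
  rw [diagMap_apply]
  simp [this]

open MeasureTheory in
/-- Volume bound for separated subsets of an ellipsoid. -/
theorem card_separated_mul_le {n : ℕ} {d : Fin n → ℝ} {δ R ρ : ℝ} (hδ : 0 < δ)
    (hd : ∀ k, δ ≤ d k) (hR : 0 ≤ R) (hρ : 0 < ρ) (S : Finset (EuclideanSpace ℂ (Fin n)))
    (hS : ∀ x ∈ S, x ∈ diagMap d '' Metric.closedBall 0 R)
    (hsep : (S : Set (EuclideanSpace ℂ (Fin n))).Pairwise fun x y => ρ < dist x y) :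
    (S.card : ℝ) * (ρ / 2) ^ (2 * n) ≤ (∏ k, d k) ^ 2 * (R + ρ / (2 * δ)) ^ (2 * n) := by
  let μ : Measure (EuclideanSpace ℂ (Fin n)) := Measure.addHaar
  have hd0 : ∀ k, 0 < d k := fun k => hδ.trans_le (hd k)
  -- All semi-axes are at least δ, so a ball of radius ρ/2 lies in the image of the ball of radius
  -- ρ/(2δ).
  have hsub : (⋃ x ∈ S, Metric.closedBall x (ρ / 2)) ⊆
      diagMap d '' Metric.closedBall 0 (R + ρ / (2 * δ)) := by
    intro y hy
    simp only [mem_iUnion, exists_prop] at hy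
    obtain ⟨x, hx, hy⟩ := hy
    obtain ⟨u, hu, rfl⟩ := hS x hx
    obtain ⟨v, hv⟩ := exists_diagMap_eq hd0 (y - diagMap d u)
    refine ⟨u + v, ?_, by simp [hv]⟩
    have h1 := norm_le_of_le_diagMap hδ hd v
    rw [hv, ← dist_eq_norm] at h1
    have h2 : ‖v‖ ≤ ρ / (2 * δ) := by
      rw [le_div_iff₀ (by positivity)]
      have := Metric.mem_closedBall.1 hy
      linarith
    rw [mem_closedBall_zero_iff] at hu ⊢
    exact (norm_add_le _ _).trans (add_le_add hu h2)
  have hdisj : (S : Set (EuclideanSpace ℂ (Fin n))).PairwiseDisjoint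
      fun x => Metric.closedBall x (ρ / 2) := fun x hx y hy hxy =>
    Metric.closedBall_disjoint_closedBall (by linarith [hsep hx hy hxy])
  have hcpt : IsCompact (diagMap d '' Metric.closedBall 0 (R + ρ / (2 * δ))) :=
    (isCompact_closedBall _ _).image (diagMap d).continuous_of_finiteDimensional
  have h1 := measureReal_mono (μ := μ) hsub hcpt.measure_lt_top.ne
  rw [measureReal_biUnion_finset hdisj (fun _ _ => Metric.isClosed_closedBall.measurableSet)
      fun _ _ => measure_closedBall_lt_top.ne,
    addHaar_real_diagMap_closedBall d (by positivity)] at h1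
  simp only [Measure.addHaar_real_closedBall μ _ (half_pos hρ).le,
    finrank_real_euclideanSpace_complex, Finset.sum_const, nsmul_eq_mul] at h1
  have hpos : 0 < μ.real (Metric.ball 0 1) :=
    ENNReal.toReal_pos (Metric.measure_ball_pos μ 0 one_pos).ne' measure_ball_lt_top.ne
  rw [← mul_assoc, ← mul_assoc] at h1
  exact le_of_mul_le_mul_right h1 hpos

open MeasureTheory in
/-- Volume bound for coverings of an ellipsoid by balls. -/
theorem le_card_mul_of_cover {n : ℕ} {d : Fin n → ℝ} {R t : ℝ} (hR : 0 ≤ R) (ht : 0 ≤ t)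
    {α : Type*} (S : Finset α) (c : α → EuclideanSpace ℂ (Fin n))
    (hS : diagMap d '' Metric.closedBall 0 R ⊆ ⋃ x ∈ S, Metric.closedBall (c x) t) :
    (∏ k, d k) ^ 2 * R ^ (2 * n) ≤ (S.card : ℝ) * t ^ (2 * n) := by
  let μ : Measure (EuclideanSpace ℂ (Fin n)) := Measure.addHaar
  have hpos : 0 < μ.real (Metric.ball 0 1) :=
    ENNReal.toReal_pos (Metric.measure_ball_pos μ 0 one_pos).ne' measure_ball_lt_top.ne
  have hfin : μ (⋃ x ∈ S, Metric.closedBall (c x) t) ≠ ⊤ :=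
    (measure_biUnion_lt_top S.finite_toSet fun _ _ => measure_closedBall_lt_top).ne
  have h1 := (measureReal_mono hS hfin).trans (measureReal_biUnion_finset_le S _)
  rw [addHaar_real_diagMap_closedBall d hR] at h1
  simp only [Measure.addHaar_real_closedBall μ _ ht,
    finrank_real_euclideanSpace_complex, Finset.sum_const, nsmul_eq_mul] at h1
  rw [← mul_assoc, ← mul_assoc] at h1
  exact le_of_mul_le_mul_right h1 hpos

/-! ### Bessel's inequality for bounded power series -/

/-- Parseval bound for polynomials on the unit circle. -/
theorem sum_sq_norm_le_of_norm_sum_le {N : ℕ} {c : ℕ → ℂ} {B : ℝ}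
    (h : ∀ z : ℂ, ‖z‖ = 1 → ‖∑ k ∈ Finset.range N, c k * z ^ k‖ ≤ B) :
    ∑ k ∈ Finset.range N, ‖c k‖ ^ 2 ≤ B ^ 2 := by
  let p : Polynomial ℂ := ∑ k ∈ Finset.range N, Polynomial.monomial k (c k)
  have hcoeff : ∀ k, p.coeff k = if k < N then c k else 0 := by
    intro k
    simp [p, Polynomial.finsetSum_coeff, Polynomial.coeff_monomial]
  have heval : ∀ z, p.eval z = ∑ k ∈ Finset.range N, c k * z ^ k := by
    intro z
    simp [p, Polynomial.eval_finsetSum]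
  have hsupp : p.support ⊆ Finset.range N := by
    intro k hk
    rw [Polynomial.mem_support_iff, hcoeff] at hk
    rw [Finset.mem_range]
    by_contra hkN
    simp [hkN] at hk
  have h1 : ∑ k ∈ Finset.range N, ‖c k‖ ^ 2 = ∑ k ∈ p.support, ‖p.coeff k‖ ^ 2 := by
    rw [Finset.sum_subset hsupp]
    · refine Finset.sum_congr rfl fun k hk => ?_
      rw [hcoeff, if_pos (Finset.mem_range.1 hk)]
    · intro k _ hk
      rw [Polynomial.notMem_support_iff.1 hk]
      simp
  rw [h1, Polynomial.sum_sq_norm_coeff_eq_circleAverage]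
  refine Real.circleAverage_mono_on_of_le_circle ?_ ?_
  · apply ContinuousOn.circleIntegrable'
    fun_prop
  · intro z hz
    have hz : ‖z‖ = 1 := by simpa using hz
    rw [heval]
    gcongr
    exact h z hz

/-- Bessel's inequality for the Taylor coefficients of a bounded function, on a circle inside
the disk of convergence. -/
theorem sum_sq_coeff_le_of_lt {a : ℕ → ℂ} {f : ℂ → ℂ} {R s M : ℝ} (hs : 0 < s) (hsR : s < R)
    (hsum : ∀ z ∈ Metric.ball (0 : ℂ) R, HasSum (fun k => a k * z ^ k) (f z))
    (hf : ∀ z ∈ Metric.ball (0 : ℂ) R, ‖f z‖ ≤ M) (n : ℕ) :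
    ∑ k ∈ Finset.range n, ‖a k‖ ^ 2 * s ^ (2 * k) ≤ M ^ 2 := by
  have hM : 0 ≤ M := (norm_nonneg _).trans (hf 0 (by simp; linarith))
  have hsm : Summable fun k => ‖a k‖ * s ^ k := by
    have := (hsum s (by simpa [abs_of_pos hs] using hsR)).summable.norm
    simpa [abs_of_pos hs] using this
  -- A long enough partial sum differs from f by at most δ on the circle of radius s, so the
  -- polynomial Parseval bound applies to it with M + δ.
  have key : ∀ δ > 0, ∑ k ∈ Finset.range n, ‖a k‖ ^ 2 * s ^ (2 * k) ≤ (M + δ) ^ 2 := by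
    intro δ hδ
    have ht := tendsto_sum_nat_add fun k => ‖a k‖ * s ^ k
    obtain ⟨N, hN, hnN⟩ := ((ht.eventually_lt_const hδ).and (eventually_ge_atTop n)).exists
    have h1 : ∀ z : ℂ, ‖z‖ = 1 → ‖∑ k ∈ Finset.range N, (a k * s ^ k) * z ^ k‖ ≤ M + δ := by
      intro z hz
      have hsz : (s * z : ℂ) ∈ Metric.ball (0 : ℂ) R := by
        simpa [hz, abs_of_pos hs] using hsR
      have h2 := hsum _ hsz
      have h3 := h2.summable.sum_add_tsum_nat_add N
      rw [h2.tsum_eq] at h3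
      have hnorm : ∀ k, ‖a (k + N) * (s * z) ^ (k + N)‖ = ‖a (k + N)‖ * s ^ (k + N) := by
        intro k
        simp [hz, abs_of_pos hs]
      have h4 : ‖∑' k, a (k + N) * (s * z : ℂ) ^ (k + N)‖ ≤ δ := by
        have := norm_tsum_le_tsum_norm (f := fun k => a (k + N) * (s * z : ℂ) ^ (k + N)) (by
          simp only [hnorm]
          exact (summable_nat_add_iff N).2 hsm)
        simp only [hnorm] at this
        linarith
      have h5 : ∑ k ∈ Finset.range N, (a k * s ^ k) * z ^ k =
          f (s * z) - ∑' k, a (k + N) * (s * z : ℂ) ^ (k + N) := by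
        rw [← h3, add_sub_cancel_right]
        simp only [mul_pow, mul_assoc]
      rw [h5]
      exact (norm_sub_le _ _).trans (add_le_add (hf _ hsz) h4)
    refine le_trans ?_ (sum_sq_norm_le_of_norm_sum_le h1)
    refine (Finset.sum_le_sum_of_subset_of_nonneg (Finset.range_mono hnN)
      fun _ _ _ => by positivity).trans (le_of_eq ?_)
    refine Finset.sum_congr rfl fun k _ => ?_
    simp [abs_of_pos hs, mul_pow, ← pow_mul, mul_comm]
  have hlim : Tendsto (fun δ : ℝ => (M + δ) ^ 2) (𝓝[>] 0) (𝓝 (M ^ 2)) := by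
    have : Continuous fun δ : ℝ => (M + δ) ^ 2 := by fun_prop
    simpa using (this.tendsto 0).mono_left nhdsWithin_le_nhds
  exact ge_of_tendsto hlim (eventually_mem_nhdsWithin.mono fun δ hδ => key δ hδ)

/-- Bessel's inequality for the Taylor coefficients of a bounded function on a disk. -/
theorem sum_sq_coeff_le {a : ℕ → ℂ} {f : ℂ → ℂ} {R M : ℝ} (hR : 0 < R)
    (hsum : ∀ z ∈ Metric.ball (0 : ℂ) R, HasSum (fun k => a k * z ^ k) (f z))
    (hf : ∀ z ∈ Metric.ball (0 : ℂ) R, ‖f z‖ ≤ M) (n : ℕ) :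
    ∑ k ∈ Finset.range n, ‖a k‖ ^ 2 * R ^ (2 * k) ≤ M ^ 2 := by
  have hc : Continuous fun s : ℝ => ∑ k ∈ Finset.range n, ‖a k‖ ^ 2 * s ^ (2 * k) := by fun_prop
  refine le_of_tendsto ((hc.tendsto R).mono_left (nhdsWithin_le_nhds (s := Iio R))) ?_
  filter_upwards [Ioo_mem_nhdsLT hR] with s hs
  exact sum_sq_coeff_le_of_lt hs.1 hs.2 hsum hf n

theorem norm_coeff_mul_pow_le {a : ℕ → ℂ} {f : ℂ → ℂ} {R M : ℝ} (hR : 0 < R)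
    (hsum : ∀ z ∈ Metric.ball (0 : ℂ) R, HasSum (fun k => a k * z ^ k) (f z))
    (hf : ∀ z ∈ Metric.ball (0 : ℂ) R, ‖f z‖ ≤ M) (k : ℕ) : ‖a k‖ * R ^ k ≤ M := by
  have hM : 0 ≤ M := (norm_nonneg _).trans (hf 0 (by simpa using hR))
  have h := (Finset.single_le_sum (f := fun k => ‖a k‖ ^ 2 * R ^ (2 * k))
    (fun _ _ => by positivity) (Finset.self_mem_range_succ k)).trans
    (sum_sq_coeff_le hR hsum hf (k + 1))
  refine le_of_sq_le_sq ?_ hM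
  rw [mul_pow, ← pow_mul, mul_comm k 2]
  exact h

/-! ### Taylor coefficients and the upper bound -/

/-- The `k`-th Taylor coefficient at the origin. -/
noncomputable def taylorCoeff (f : ℂ → ℂ) (k : ℕ) : ℂ :=
  (k.factorial : ℂ)⁻¹ * iteratedDeriv k f 0

theorem hasSum_taylorCoeff {R M : ℝ} {f : ℂ → ℂ} (hf : f ∈ analyticBounded R M) {z : ℂ}
    (hz : z ∈ Metric.ball (0 : ℂ) R) : HasSum (fun k => taylorCoeff f k * z ^ k) (f z) := by
  have := Complex.hasSum_taylorSeries_on_ball hf.1.differentiableOn hz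
  simp only [sub_zero, smul_eq_mul] at this
  have h : (fun k => taylorCoeff f k * z ^ k) =
      fun n : ℕ => (n.factorial : ℂ)⁻¹ * (z ^ n * iteratedDeriv n f 0) := by
    funext k
    rw [taylorCoeff]
    ring
  rwa [h]

theorem norm_sub_le_of_mem_ball {r r' M : ℝ} {f g : ℂ → ℂ} (hrr' : r < r')
    (hf : f ∈ analyticBounded r' M) (hg : g ∈ analyticBounded r' M) {z : ℂ}
    (hz : z ∈ Metric.ball (0 : ℂ) r) : ‖f z - g z‖ ≤ 2 * M := by
  have hz' := Metric.ball_subset_ball hrr'.le hz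
  linarith [norm_sub_le (f z) (g z), hf.2 z hz', hg.2 z hz']

/-- The uniform bound 2M makes the supremum genuine; a real `⨆` over an unbounded family would be 0.
-/
theorem norm_sub_le_diskDist {r r' M : ℝ} {f g : ℂ → ℂ} (hrr' : r < r')
    (hf : f ∈ analyticBounded r' M) (hg : g ∈ analyticBounded r' M) {z : ℂ}
    (hz : z ∈ Metric.ball (0 : ℂ) r) : ‖f z - g z‖ ≤ diskDist r f g := by
  refine le_ciSup (f := fun z : Metric.ball (0 : ℂ) r => ‖f z - g z‖) ⟨2 * M, ?_⟩ ⟨z, hz⟩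
  rintro _ ⟨w, rfl⟩
  exact norm_sub_le_of_mem_ball hrr' hf hg w.2

/-- The first `n` Taylor coefficients, rescaled to the disk of radius `r`. -/
noncomputable def coeffVec (r : ℝ) (n : ℕ) (f : ℂ → ℂ) : EuclideanSpace ℂ (Fin n) :=
  WithLp.toLp 2 fun k => taylorCoeff f k * (r : ℂ) ^ (k : ℕ)

/-- The preimage is the coefficient vector rescaled to radius r', whose norm is at most M by
Bessel's inequality. -/
theorem coeffVec_mem {r r' M : ℝ} (hr : 0 < r) (hrr' : r < r') (hM : 0 < M) (n : ℕ) {f : ℂ → ℂ}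
    (hf : f ∈ analyticBounded r' M) :
    coeffVec r n f ∈
      diagMap (fun k : Fin n => (r / r') ^ (k : ℕ)) '' Metric.closedBall 0 M := by
  have hr' : 0 < r' := hr.trans hrr'
  refine ⟨WithLp.toLp 2 fun k => taylorCoeff f k * (r' : ℂ) ^ (k : ℕ), ?_, ?_⟩
  · rw [mem_closedBall_zero_iff, EuclideanSpace.norm_eq]
    refine Real.sqrt_le_iff.2 ⟨hM.le, ?_⟩
    refine le_trans (le_of_eq ?_)
      (sum_sq_coeff_le hr' (fun z hz => hasSum_taylorCoeff hf hz) hf.2 n)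
    rw [Finset.sum_range]
    refine Finset.sum_congr rfl fun k _ => ?_
    simp [abs_of_pos hr', mul_pow, ← pow_mul, mul_comm]
  · ext k
    rw [diagMap_apply]
    have : (r' : ℂ) ≠ 0 := by exact_mod_cast hr'.ne'
    simp only [coeffVec]
    push_cast
    rw [div_pow]
    field_simp

/-- Cauchy–Schwarz. This √n, used in both bounds, is the source of the second-order term of the
entropy. -/
theorem sum_norm_le_sqrt_mul_norm {n : ℕ} (v : EuclideanSpace ℂ (Fin n)) :
    ∑ k, ‖v k‖ ≤ √n * ‖v‖ := by
  rw [EuclideanSpace.norm_eq, ← Real.sqrt_mul (Nat.cast_nonneg n)]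
  refine Real.le_sqrt_of_sq_le ?_
  simpa using sq_sum_le_card_mul_sum_sq (s := Finset.univ) (f := fun k => ‖v k‖)

/-- The distance on the smaller disk is controlled by the first Taylor coefficients. -/
theorem diskDist_le {r r' M : ℝ} (hr : 0 < r) (hrr' : r < r') (hM : 0 < M) (n : ℕ) {f g : ℂ → ℂ}
    (hf : f ∈ analyticBounded r' M) (hg : g ∈ analyticBounded r' M) :
    diskDist r f g ≤ √n * dist (coeffVec r n f) (coeffVec r n g) +
      2 * M * (r / r') ^ n / (1 - r / r') := by
  have hr' : 0 < r' := hr.trans hrr'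
  have hx0 : 0 ≤ r / r' := by positivity
  have hx1 : r / r' < 1 := (div_lt_one hr').2 hrr'
  have hx2 : 0 < 1 - r / r' := by linarith
  refine Real.iSup_le ?_ (by positivity)
  rintro ⟨z, hz⟩
  have hsum : ∀ w ∈ Metric.ball (0 : ℂ) r',
      HasSum (fun k => (taylorCoeff f k - taylorCoeff g k) * w ^ k) (f w - g w) := by
    intro w hw
    simpa only [sub_mul] using (hasSum_taylorCoeff hf hw).sub (hasSum_taylorCoeff hg hw)
  have hbd : ∀ w ∈ Metric.ball (0 : ℂ) r', ‖f w - g w‖ ≤ 2 * M := fun w hw => by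
    linarith [norm_sub_le (f w) (g w), hf.2 w hw, hg.2 w hw]
  have hz1 : ‖z‖ < r := by simpa using hz
  have h1 := hsum z (Metric.ball_subset_ball hrr'.le hz)
  have h2 := h1.summable.sum_add_tsum_nat_add n
  rw [h1.tsum_eq] at h2
  rw [← h2]
  refine (norm_add_le _ _).trans (add_le_add ?_ ?_)
  · rw [dist_eq_norm]
    refine le_trans ?_ (sum_norm_le_sqrt_mul_norm _)
    refine (norm_sum_le _ _).trans ?_
    rw [Finset.sum_range]
    refine Finset.sum_le_sum fun k _ => ?_
    have : (coeffVec r n f - coeffVec r n g) k =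
        (taylorCoeff f k - taylorCoeff g k) * (r : ℂ) ^ (k : ℕ) := by
      simp [coeffVec, sub_mul]
    rw [this, norm_mul, norm_mul, norm_pow, norm_pow, Complex.norm_real, Real.norm_eq_abs,
      abs_of_pos hr]
    gcongr
  · have hgeo : HasSum (fun k : ℕ => 2 * M * (r / r') ^ (k + n))
        (2 * M * (r / r') ^ n / (1 - r / r')) := by
      have := (hasSum_geometric_of_lt_one hx0 hx1).mul_left (2 * M * (r / r') ^ n)
      have h : (fun k : ℕ => 2 * M * (r / r') ^ (k + n)) =
          fun k => 2 * M * (r / r') ^ n * (r / r') ^ k := by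
        funext k
        ring
      rwa [h, div_eq_mul_inv]
    refine tsum_of_norm_bounded hgeo fun k => ?_
    have h3 := norm_coeff_mul_pow_le hr' hsum hbd (k + n)
    rw [norm_mul, norm_pow, div_pow, mul_div_assoc', le_div_iff₀ (by positivity)]
    calc ‖taylorCoeff f (k + n) - taylorCoeff g (k + n)‖ * ‖z‖ ^ (k + n) * r' ^ (k + n)
        = (‖taylorCoeff f (k + n) - taylorCoeff g (k + n)‖ * r' ^ (k + n)) * ‖z‖ ^ (k + n) := by
          ring
      _ ≤ 2 * M * r ^ (k + n) := by gcongr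

/-- A separated set with more than ⌊B⌋ points, possibly infinite, would contain a finite one with
exactly ⌊B⌋ + 1. -/
theorem packingNumber_le_floor {E : Type*} [PseudoEMetricSpace E] {A : Set E} {ρ : ℝ≥0} {B : ℝ}
    (h : ∀ S : Finset E, (S : Set E) ⊆ A → Metric.IsSeparated ρ (S : Set E) →
      (S.card : ℝ) ≤ B) : Metric.packingNumber ρ A ≤ (⌊B⌋₊ : ℕ∞) := by
  refine iSup_le fun C => iSup_le fun hCA => iSup_le fun hC => ?_
  by_contra! hlt
  obtain ⟨t, htC, ht⟩ := Set.exists_subset_encard_eq (Order.add_one_le_of_lt hlt)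
  have hfin : t.Finite := Set.finite_of_encard_eq_coe (k := ⌊B⌋₊ + 1) (by simpa using ht)
  have h1 := h hfin.toFinset (by simpa using htC.trans hCA) (by
    simpa [Metric.IsSeparated] using Set.Pairwise.mono htC hC)
  have h2 : hfin.toFinset.card = ⌊B⌋₊ + 1 := by
    rw [hfin.encard_eq_coe_toFinset_card] at ht
    exact_mod_cast ht
  rw [h2] at h1
  push_cast at h1
  linarith [Nat.lt_floor_add_one B]

/-- Upper bound for the covering numbers. -/
theorem coveringNum_le {r r' M : ℝ} (hr : 0 < r) (hrr' : r < r') (hM : 0 < M)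
    {X : Type*} [MetricSpace X] (ι : analyticBounded r' M → X)
    (hι : ∀ f g : analyticBounded r' M, dist (ι f) (ι g) = diskDist r f g)
    {n : ℕ} (hn : 0 < n) {ε : ℝ} (hε : 0 < ε)
    (htail : 2 * M * (r / r') ^ n / (1 - r / r') ≤ ε / 2) :
    coveringNum ε (range ι) ≠ ⊤ ∧
    ((coveringNum ε (range ι)).toNat : ℝ) * (ε / (4 * √n)) ^ (2 * n) ≤
      (∏ k : Fin n, (r / r') ^ (k : ℕ)) ^ 2 *
        (M + ε / (4 * √n) / (r / r') ^ n) ^ (2 * n) := by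
  have hr' : 0 < r' := hr.trans hrr'
  have hx0 : 0 < r / r' := by positivity
  have hx1 : r / r' < 1 := (div_lt_one hr').2 hrr'
  have hsn : 0 < √(n : ℝ) := Real.sqrt_pos.2 (by exact_mod_cast hn)
  -- Coefficient vectors at distance ρ contribute at most √n ρ = ε/2 to the sup distance; the tail
  -- takes the other half.
  set ρ : ℝ := ε / (2 * √n) with hρdef
  have hρ : 0 < ρ := by positivity
  have hρ2 : ε / (4 * √n) = ρ / 2 := by rw [hρdef]; field_simp; norm_num
  rw [hρ2]
  set V : ℝ := (∏ k : Fin n, (r / r') ^ (k : ℕ)) ^ 2 * (M + ρ / 2 / (r / r') ^ n) ^ (2 * n)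
    with hV
  have hV0 : 0 ≤ V := by positivity
  let P : analyticBounded r' M → EuclideanSpace ℂ (Fin n) := fun f => coeffVec r n f
  have hpack : Metric.packingNumber ρ.toNNReal (range P) ≤ (⌊V / (ρ / 2) ^ (2 * n)⌋₊ : ℕ∞) := by
    refine packingNumber_le_floor fun S hSA hS => ?_
    rw [le_div_iff₀ (by positivity)]
    have := card_separated_mul_le (d := fun k : Fin n => (r / r') ^ (k : ℕ)) (pow_pos hx0 n)
      (fun k => pow_le_pow_of_le_one hx0.le hx1.le k.2.le) hM.le hρ S (fun x hx => by
        obtain ⟨f, rfl⟩ := hSA hx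
        exact coeffVec_mem hr hrr' hM n f.2) (fun x hx y hy hxy => by
        have h1 : (ρ.toNNReal : ℝ≥0∞) < edist x y := hS hx hy hxy
        rw [edist_dist] at h1
        exact (ENNReal.ofReal_lt_ofReal_iff_of_nonneg hρ.le).1 h1)
    rwa [div_div, ← hV] at *
  have hcov := (Metric.coveringNumber_le_packingNumber ρ.toNNReal (range P)).trans hpack
  obtain ⟨C, hCA, -, hCcov, hCcard⟩ := Metric.exists_set_encard_eq_coveringNumber
    (ne_top_of_le_ne_top (ENat.natCast_ne_top _) hcov)
  have : Nonempty (analyticBounded r' M) := ⟨⟨fun _ => 0, analyticOnNhd_const, by simp [hM.le]⟩⟩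
  have hle : coveringNum ε (range ι) ≤ (⌊V / (ρ / 2) ^ (2 * n)⌋₊ : ℕ∞) := by
    rw [← hCcard] at hcov
    -- The covering of the coefficient vectors is internal, so each centre lifts to a function of
    -- the class, and the lifts serve as centres in X.
    refine le_trans ?_ ((encard_image_le (fun c => ι (Function.invFun P c)) C).trans hcov)
    refine Metric.IsCover.externalCoveringNumber_le_encard ?_
    rintro _ ⟨f, rfl⟩
    obtain ⟨c, hc, hfc⟩ := hCcov (mem_range_self f)
    refine ⟨_, mem_image_of_mem _ hc, ?_⟩
    obtain ⟨g, rfl⟩ := hCA hc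
    have hg : P (Function.invFun P (P g)) = P g := Function.invFun_eq ⟨g, rfl⟩
    set g' := Function.invFun P (P g)
    change edist (P f) (P g) ≤ _ at hfc
    change edist (ι f) (ι g') ≤ _
    rw [← hg, edist_dist] at hfc
    rw [edist_dist]
    have h1 : dist (P f) (P g') ≤ ρ := (ENNReal.ofReal_le_ofReal_iff hρ.le).1 hfc
    refine (ENNReal.ofReal_le_ofReal_iff hε.le).2 ?_
    rw [hι]
    refine (diskDist_le hr hrr' hM n f.2 g'.2).trans ?_
    have h2 : √n * dist (P f) (P g') ≤ √n * ρ := by gcongr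
    have h3 : √n * ρ = ε / 2 := by rw [hρdef]; field_simp
    linarith
  refine ⟨ne_top_of_le_ne_top (ENat.natCast_ne_top _) hle, ?_⟩
  rw [← le_div_iff₀ (by positivity)]
  refine le_trans ?_ (Nat.floor_le (a := V / (ρ / 2) ^ (2 * n)) (by positivity))
  exact_mod_cast ENat.toNat_le_of_le_natCast hle

/-! ### Polynomials and the lower bound -/

/-- The polynomial with coefficient vector `b` on the disk of radius `r`. -/
noncomputable def diskPoly (r : ℝ) {n : ℕ} (b : EuclideanSpace ℂ (Fin n)) (z : ℂ) : ℂ :=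
  ∑ k, b k * (z / r) ^ (k : ℕ)

/-- On D(0; r') the weight (r/r')^k cancels the growth of (z/r)^k, leaving an ℓ¹ norm;
Cauchy–Schwarz bounds it by √n · M/√n. -/
theorem diskPoly_mem {r r' M : ℝ} (hr : 0 < r) (hrr' : r < r') {n : ℕ} (hn : 0 < n)
    {b : EuclideanSpace ℂ (Fin n)}
    (hb : b ∈ diagMap (fun k : Fin n => (r / r') ^ (k : ℕ)) '' Metric.closedBall 0 (M / √n)) :
    diskPoly r b ∈ analyticBounded r' M := by
  have hr' : 0 < r' := hr.trans hrr'
  have hsn : 0 < √(n : ℝ) := Real.sqrt_pos.2 (by exact_mod_cast hn)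
  constructor
  · have : Differentiable ℂ (diskPoly r b) := by
      unfold diskPoly
      fun_prop
    exact fun z _ => this.analyticAt z
  · intro z hz
    have hz1 : ‖z‖ < r' := by simpa using hz
    obtain ⟨v, hv, rfl⟩ := hb
    rw [mem_closedBall_zero_iff, le_div_iff₀ hsn] at hv
    refine (norm_sum_le _ _).trans (le_trans ?_ ((sum_norm_le_sqrt_mul_norm v).trans
      ((mul_comm _ _).trans_le hv)))
    refine Finset.sum_le_sum fun k _ => ?_
    rw [diagMap_apply]
    have h1 : ‖z / r‖ ≤ r' / r := by
      rw [norm_div, Complex.norm_real, Real.norm_eq_abs, abs_of_pos hr]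
      gcongr
    rw [norm_mul, norm_mul, norm_pow, Complex.norm_real, Real.norm_eq_abs,
      abs_of_pos (by positivity)]
    calc (r / r') ^ (k : ℕ) * ‖v k‖ * ‖z / r‖ ^ (k : ℕ)
        ≤ (r / r') ^ (k : ℕ) * ‖v k‖ * (r' / r) ^ (k : ℕ) := by gcongr
      _ = ‖v k‖ * ((r / r') * (r' / r)) ^ (k : ℕ) := by rw [mul_pow]; ring
      _ = ‖v k‖ := by
        rw [div_mul_div_cancel₀ hr'.ne', div_self hr.ne', one_pow, mul_one]

/-- The distance of two polynomials is at least that of their coefficient vectors. -/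
theorem dist_le_diskDist_diskPoly {r r' M : ℝ} (hr : 0 < r) (hrr' : r < r') {n : ℕ}
    {b c : EuclideanSpace ℂ (Fin n)} (hb : diskPoly r b ∈ analyticBounded r' M)
    (hc : diskPoly r c ∈ analyticBounded r' M) :
    dist b c ≤ diskDist r (diskPoly r b) (diskPoly r c) := by
  -- The Taylor coefficients of the difference: dividing by r^k undoes the rescaling, and zeros fill
  -- the degrees from n on.
  let a : ℕ → ℂ := fun k => if h : k < n then (b - c) ⟨k, h⟩ / (r : ℂ) ^ k else 0
  have hrc : (r : ℂ) ≠ 0 := by exact_mod_cast hr.ne'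
  have hsum : ∀ z ∈ Metric.ball (0 : ℂ) r,
      HasSum (fun k => a k * z ^ k) (diskPoly r b z - diskPoly r c z) := by
    intro z _
    have h := hasSum_sum_of_ne_finset_zero (f := fun k => a k * z ^ k) (s := Finset.range n)
      (L := .unconditional ℕ) (fun k hk => by
        have : ¬ k < n := by simpa using hk
        simp [a, this])
    rw [Finset.sum_range] at h
    convert h using 1
    rw [diskPoly, diskPoly, ← Finset.sum_sub_distrib]
    refine Finset.sum_congr rfl fun k _ => ?_
    simp only [a, k.2, dif_pos, div_pow, Fin.eta, PiLp.sub_apply]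
    ring
  have h := sum_sq_coeff_le hr hsum (fun z hz => norm_sub_le_diskDist hrr' hb hc hz) n
  have h0 : 0 ≤ diskDist r (diskPoly r b) (diskPoly r c) :=
    Real.iSup_nonneg fun _ => norm_nonneg _
  rw [dist_eq_norm, EuclideanSpace.norm_eq]
  refine Real.sqrt_le_iff.2 ⟨h0, le_trans (le_of_eq ?_) h⟩
  rw [Finset.sum_range]
  refine Finset.sum_congr rfl fun k _ => ?_
  have hrk : r ^ (k : ℕ) ≠ 0 := (pow_pos hr _).ne'
  simp only [a, k.2, dif_pos, Fin.eta, norm_div, norm_pow, Complex.norm_real, Real.norm_eq_abs,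
    abs_of_pos hr]
  rw [mul_comm 2, pow_mul, ← mul_pow, div_mul_cancel₀ _ hrk]

/-- Lower bound for the covering numbers. -/
theorem le_coveringNum {r r' M : ℝ} (hr : 0 < r) (hrr' : r < r') (hM : 0 < M)
    {X : Type*} [MetricSpace X] (ι : analyticBounded r' M → X)
    (hι : ∀ f g : analyticBounded r' M, dist (ι f) (ι g) = diskDist r f g)
    {n : ℕ} (hn : 0 < n) {ε : ℝ} (hε : 0 < ε) (hfin : coveringNum ε (range ι) ≠ ⊤) :
    (∏ k : Fin n, (r / r') ^ (k : ℕ)) ^ 2 * (M / √n) ^ (2 * n) ≤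
      ((coveringNum ε (range ι)).toNat : ℝ) * (2 * ε) ^ (2 * n) := by
  obtain ⟨C, hC, hCcard⟩ : ∃ C : Set X, Metric.IsCover ε.toNNReal (range ι) C ∧
      C.encard = coveringNum ε (range ι) := by
    have : Nonempty {C : Set X // Metric.IsCover ε.toNNReal (range ι) C} :=
      ⟨⟨range ι, Metric.IsCover.rfl⟩⟩
    obtain ⟨C, hC⟩ := ENat.exists_eq_iInf
      fun C : {C : Set X // Metric.IsCover ε.toNNReal (range ι) C} => C.1.encard
    refine ⟨C.1, C.2, ?_⟩
    rw [hC, coveringNum, Metric.externalCoveringNumber, iInf_subtype']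
  have hCfin : C.Finite := by
    rw [← Set.encard_ne_top_iff, hCcard]
    exact hfin
  have hcard : (coveringNum ε (range ι)).toNat = hCfin.toFinset.card := by
    rw [← hCcard, hCfin.encard_eq_coe_toFinset_card, ENat.toNat_natCast]
  rw [hcard]
  set Q := diagMap (fun k : Fin n => (r / r') ^ (k : ℕ)) '' Metric.closedBall 0 (M / √n) with hQ
  have hmem : ∀ b ∈ Q, diskPoly r b ∈ analyticBounded r' M := fun b hb =>
    diskPoly_mem hr hrr' hn hb
  -- Centres in X need not be functions. Each x is replaced by some polynomial within ε of it, which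
  -- doubles the radius; if there is none, the value 0 is arbitrary and the claim vacuous.
  have hex : ∀ x : X, ∃ c : EuclideanSpace ℂ (Fin n), ∀ (b) (hb : b ∈ Q),
      dist (ι ⟨diskPoly r b, hmem b hb⟩) x ≤ ε → dist b c ≤ 2 * ε := by
    intro x
    by_cases h : ∃ (c : _) (hc : c ∈ Q), dist (ι ⟨diskPoly r c, hmem c hc⟩) x ≤ ε
    · obtain ⟨c, hc, hcx⟩ := h
      refine ⟨c, fun b hb hbx => ?_⟩
      refine (dist_le_diskDist_diskPoly hr hrr' (hmem b hb) (hmem c hc)).trans ?_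
      rw [← hι ⟨_, hmem b hb⟩ ⟨_, hmem c hc⟩]
      linarith [dist_triangle_right (ι ⟨_, hmem b hb⟩) (ι ⟨_, hmem c hc⟩) x]
    · push Not at h
      exact ⟨0, fun b hb hbx => absurd hbx (h b hb).not_ge⟩
  choose c hc using hex
  refine le_card_mul_of_cover (by positivity) (by positivity) hCfin.toFinset c fun b hb => ?_
  obtain ⟨x, hx, hbx⟩ := hC (mem_range_self ⟨diskPoly r b, hmem b hb⟩)
  simp only [mem_iUnion, exists_prop, Finite.mem_toFinset]
  refine ⟨x, hx, hc x b hb ?_⟩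
  change edist _ _ ≤ _ at hbx
  rw [edist_dist] at hbx
  exact (ENNReal.ofReal_le_ofReal_iff hε.le).1 hbx

/-! ### Logarithmic form of the bounds -/

theorem logb_prod_pow (x : ℝ) (n : ℕ) :
    Real.logb 2 ((∏ k : Fin n, x ^ (k : ℕ)) ^ 2) = n * (n - 1) * Real.logb 2 x := by
  rw [Finset.prod_pow_eq_pow_sum, ← Finset.sum_range (fun k => k), ← pow_mul,
    Finset.sum_range_id_mul_two, Real.logb_pow]
  rcases n with _ | n
  · simp
  · push_cast
    simp

theorem logb_sqrt {y : ℝ} (hy : 0 ≤ y) : Real.logb 2 √y = Real.logb 2 y / 2 := by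
  rw [Real.logb, Real.logb, Real.log_sqrt hy]
  ring

theorem nat_mul_logb_le {n : ℕ} (hn : 0 < n) {m : ℝ} (hnm : (n : ℝ) ≤ m) (K : ℝ) :
    n * Real.logb 2 n + K * n ≤ m * Real.logb 2 m + |K| * m := by
  have hn1 : (1 : ℝ) ≤ n := by exact_mod_cast hn
  have hm : 0 ≤ m := by linarith
  have h1 : Real.logb 2 n ≤ Real.logb 2 m :=
    Real.logb_le_logb_of_le one_lt_two (by linarith) hnm
  have h0 : 0 ≤ Real.logb 2 n := Real.logb_nonneg one_lt_two hn1
  have h2 : K * n ≤ |K| * n := by gcongr; exact le_abs_self K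
  have h3 : |K| * n ≤ |K| * m := by gcongr
  have h4 : n * Real.logb 2 n ≤ m * Real.logb 2 m := by gcongr
  linarith

theorem logb_ratio_pos {r r' : ℝ} (hr : 0 < r) (hrr' : r < r') : 0 < Real.logb 2 (r' / r) :=
  Real.logb_pos one_lt_two ((one_lt_div hr).2 hrr')

theorem ratio_pow_eq {r r' : ℝ} (hr : 0 < r) (hrr' : r < r') (n : ℕ) :
    (r / r') ^ n = (2 : ℝ) ^ (-(Real.logb 2 (r' / r) * n)) := by
  have hr' : 0 < r' := hr.trans hrr'
  rw [← inv_div r' r, inv_pow, Real.rpow_neg two_pos.le, Real.rpow_mul two_pos.le,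
    Real.rpow_logb two_pos (by norm_num) (by positivity), Real.rpow_natCast]

theorem eq_two_rpow_neg_logb_inv {ε : ℝ} (hε : 0 < ε) : ε = (2 : ℝ) ^ (-Real.logb 2 ε⁻¹) := by
  rw [Real.logb_inv, neg_neg, Real.rpow_logb two_pos (by norm_num) hε]

/-- The hypothesis is the logarithm of (r/r')^n ≤ ε(1 - r/r')/(4M). -/
theorem geometric_tail_le {r r' M : ℝ} (hr : 0 < r) (hrr' : r < r') (hM : 0 < M) {ε : ℝ} (hε : 0 < ε)
    {n : ℕ} (h : Real.logb 2 ε⁻¹ + Real.logb 2 (4 * M / (1 - r / r')) ≤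
      Real.logb 2 (r' / r) * n) :
    2 * M * (r / r') ^ n / (1 - r / r') ≤ ε / 2 := by
  have hr' : 0 < r' := hr.trans hrr'
  have hx2 : 0 < 1 - r / r' := by linarith [(div_lt_one hr').2 hrr']
  have h1 : (r / r') ^ n ≤ ε * (4 * M / (1 - r / r'))⁻¹ := by
    rw [ratio_pow_eq hr hrr']
    calc (2 : ℝ) ^ (-(Real.logb 2 (r' / r) * n))
        ≤ (2 : ℝ) ^ (-Real.logb 2 ε⁻¹ + -Real.logb 2 (4 * M / (1 - r / r'))) :=
          Real.rpow_le_rpow_of_exponent_le one_le_two (by linarith)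
      _ = ε * (4 * M / (1 - r / r'))⁻¹ := by
        rw [Real.rpow_add two_pos, ← eq_two_rpow_neg_logb_inv hε, Real.rpow_neg two_pos.le,
          Real.rpow_logb two_pos (by norm_num) (by positivity)]
  calc 2 * M * (r / r') ^ n / (1 - r / r')
      ≤ 2 * M * (ε * (4 * M / (1 - r / r'))⁻¹) / (1 - r / r') := by gcongr
    _ = ε / 2 := by
      generalize 1 - r / r' = y at hx2
      field_simp
      norm_num

theorem coveringNum_ne_top {r r' M : ℝ} (hr : 0 < r) (hrr' : r < r') (hM : 0 < M)
    {X : Type*} [MetricSpace X] (ι : analyticBounded r' M → X)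
    (hι : ∀ f g : analyticBounded r' M, dist (ι f) (ι g) = diskDist r f g)
    {ε : ℝ} (hε : 0 < ε) : coveringNum ε (range ι) ≠ ⊤ := by
  have hlam := logb_ratio_pos hr hrr'
  obtain ⟨n, hn⟩ := exists_nat_ge
    ((Real.logb 2 ε⁻¹ + Real.logb 2 (4 * M / (1 - r / r'))) / Real.logb 2 (r' / r))
  refine (coveringNum_le hr hrr' hM ι hι n.succ_pos hε (geometric_tail_le hr hrr' hM hε ?_)).1
  rw [div_le_iff₀' hlam] at hn
  push_cast
  linarith

/-- The lower bound with n = 1 suffices; positivity keeps the logarithms away from the default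
`Real.logb 2 0 = 0`. -/
theorem coveringNum_toNat_pos {r r' M : ℝ} (hr : 0 < r) (hrr' : r < r') (hM : 0 < M)
    {X : Type*} [MetricSpace X] (ι : analyticBounded r' M → X)
    (hι : ∀ f g : analyticBounded r' M, dist (ι f) (ι g) = diskDist r f g)
    {ε : ℝ} (hε : 0 < ε) : 0 < ((coveringNum ε (range ι)).toNat : ℝ) := by
  have hr' : 0 < r' := hr.trans hrr'
  have h := le_coveringNum hr hrr' hM ι hι one_pos hε (coveringNum_ne_top hr hrr' hM ι hι hε)
  refine pos_of_mul_pos_left (lt_of_lt_of_le ?_ h) (by positivity)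
  have : 0 < ∏ k : Fin 1, (r / r') ^ (k : ℕ) := Finset.prod_pos fun k _ => by positivity
  positivity

/-- Upper bound for the metric entropy. -/
theorem metricEntropy_le {r r' M : ℝ} (hr : 0 < r) (hrr' : r < r') (hM : 0 < M)
    {X : Type*} [MetricSpace X] (ι : analyticBounded r' M → X)
    (hι : ∀ f g : analyticBounded r' M, dist (ι f) (ι g) = diskDist r f g) :
    ∃ D K : ℝ, 0 ≤ D ∧ 0 ≤ K ∧ ∀ ε : ℝ, 0 < ε → D ≤ Real.logb 2 ε⁻¹ → ∀ m : ℝ,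
      Real.logb 2 ε⁻¹ / Real.logb 2 (r' / r) + D ≤ m →
      metricEntropy ε (range ι) ≤ Real.logb 2 ε⁻¹ ^ 2 / Real.logb 2 (r' / r) +
        (m * Real.logb 2 m + K * m) := by
  have hr' : 0 < r' := hr.trans hrr'
  have hx0 : 0 < r / r' := by positivity
  have hlam := logb_ratio_pos hr hrr'
  set lam := Real.logb 2 (r' / r) with hlamdef
  set C := Real.logb 2 (4 * M / (1 - r / r')) with hC
  set B : ℝ := M + 2 ^ (C + lam) with hB
  have hB0 : 0 < B := by positivity
  -- In the first constant, |C| + 1 makes L + C positive, while |C|/λ + 1 absorbs the shift and the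
  -- rounding in n = ⌈(L + C)/λ⌉.
  refine ⟨|C| + |C| / lam + 1, |4 + lam + 2 * Real.logb 2 B|, by positivity, by positivity,
    fun ε hε hL m hm => ?_⟩
  set L := Real.logb 2 ε⁻¹ with hLdef
  have hCabs := neg_abs_le C
  have hdiv : 0 ≤ |C| / lam := by positivity
  have hLC : 0 < (L + C) / lam := div_pos (by linarith) hlam
  set n := ⌈(L + C) / lam⌉₊ with hndef
  have hn : 0 < n := Nat.ceil_pos.2 hLC
  have hn1 : (1 : ℝ) ≤ n := by exact_mod_cast hn
  have hn_ge : L + C ≤ lam * n := by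
    rw [← div_le_iff₀' hlam]
    exact Nat.le_ceil _
  have hn_lt : (n : ℝ) < (L + C) / lam + 1 := Nat.ceil_lt_add_one hLC.le
  have hn_lt' : lam * n ≤ L + C + lam := by
    have := mul_le_mul_of_nonneg_left hn_lt.le hlam.le
    rwa [mul_add, mul_div_cancel₀ _ hlam.ne', mul_one] at this
  have hnm : (n : ℝ) ≤ m := by
    have : (L + C) / lam ≤ L / lam + |C| / lam := by
      rw [← add_div]
      gcongr
      exact le_abs_self C
    linarith [abs_nonneg C]
  have hsn : 1 ≤ √(n : ℝ) := Real.one_le_sqrt.2 hn1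
  have hmain := (coveringNum_le hr hrr' hM ι hι hn hε (geometric_tail_le hr hrr' hM hε hn_ge)).2
  have hNpos := coveringNum_toNat_pos hr hrr' hM ι hι hε
  -- As n exceeds (L + C)/λ by at most 1, the smallest weight (r/r')^n is still comparable to ε, so
  -- the enlarged ellipsoid has radius bounded by B uniformly in ε.
  have hpow : ε / (4 * √n) / (r / r') ^ n ≤ 2 ^ (C + lam) := by
    rw [div_le_iff₀ (by positivity), ratio_pow_eq hr hrr', ← Real.rpow_add two_pos]
    calc ε / (4 * √n) ≤ ε := div_le_self hε.le (by linarith)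
      _ = 2 ^ (-L) := eq_two_rpow_neg_logb_inv hε
      _ ≤ _ := Real.rpow_le_rpow_of_exponent_le one_le_two (by linarith)
  have hprod : 0 < ∏ k : Fin n, (r / r') ^ (k : ℕ) := Finset.prod_pos fun k _ => by positivity
  have hmain2 := hmain.trans (mul_le_mul_of_nonneg_left
    (pow_le_pow_left₀ (by positivity) (add_le_add_right hpow M) (2 * n)) (by positivity))
  have hlog := Real.logb_le_logb_of_le one_lt_two (by positivity) hmain2
  rw [Real.logb_mul (by positivity) (by positivity), Real.logb_mul (by positivity) (by positivity),
    logb_prod_pow, Real.logb_pow, Real.logb_pow, Real.logb_div hε.ne' (by positivity),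
    Real.logb_mul (by norm_num) (by positivity), logb_sqrt (by positivity),
    ← inv_div r' r, Real.logb_inv, ← hlamdef, ← hB] at hlog
  have h4 : Real.logb 2 4 = 2 := by
    rw [show (4 : ℝ) = 2 ^ (2 : ℕ) by norm_num, Real.logb_pow, Real.logb_self_eq_one one_lt_two]
    norm_num
  have hεL : Real.logb 2 ε = -L := by rw [hLdef, Real.logb_inv, neg_neg]
  rw [h4, hεL] at hlog
  push_cast at hlog
  -- Completing the square: the gap is (λn - L)²/λ.
  have hsq : 2 * n * L - lam * n ^ 2 ≤ L ^ 2 / lam := by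
    rw [le_div_iff₀ hlam]
    nlinarith [sq_nonneg (lam * n - L)]
  have hfin := nat_mul_logb_le hn hnm (4 + lam + 2 * Real.logb 2 B)
  rw [metricEntropy]
  linarith

/-- Lower bound for the metric entropy. -/
theorem le_metricEntropy {r r' M : ℝ} (hr : 0 < r) (hrr' : r < r') (hM : 0 < M)
    {X : Type*} [MetricSpace X] (ι : analyticBounded r' M → X)
    (hι : ∀ f g : analyticBounded r' M, dist (ι f) (ι g) = diskDist r f g) :
    ∃ K : ℝ, 0 ≤ K ∧ ∀ ε : ℝ, 0 < ε → 0 < Real.logb 2 ε⁻¹ → ∀ m : ℝ,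
      Real.logb 2 ε⁻¹ / Real.logb 2 (r' / r) + 1 ≤ m →
      Real.logb 2 ε⁻¹ ^ 2 / Real.logb 2 (r' / r) - (m * Real.logb 2 m + K * m) ≤
        metricEntropy ε (range ι) := by
  have hr' : 0 < r' := hr.trans hrr'
  have hx0 : 0 < r / r' := by positivity
  have hlam := logb_ratio_pos hr hrr'
  set lam := Real.logb 2 (r' / r) with hlamdef
  refine ⟨|2 - 2 * Real.logb 2 M|, by positivity, fun ε hε hL m hm => ?_⟩
  set L := Real.logb 2 ε⁻¹ with hLdef
  have hLC : 0 < L / lam := div_pos hL hlam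
  set n := ⌈L / lam⌉₊ with hndef
  have hn : 0 < n := Nat.ceil_pos.2 hLC
  have hn1 : (1 : ℝ) ≤ n := by exact_mod_cast hn
  have hn_ge : L ≤ lam * n := by
    rw [← div_le_iff₀' hlam]
    exact Nat.le_ceil _
  have hn_lt : (n : ℝ) < L / lam + 1 := Nat.ceil_lt_add_one hLC.le
  have hn_lt' : lam * n ≤ L + lam := by
    have := mul_le_mul_of_nonneg_left hn_lt.le hlam.le
    rwa [mul_add, mul_div_cancel₀ _ hlam.ne', mul_one] at this
  have hnm : (n : ℝ) ≤ m := by linarith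
  have hmain := le_coveringNum hr hrr' hM ι hι hn hε (coveringNum_ne_top hr hrr' hM ι hι hε)
  have hNpos := coveringNum_toNat_pos hr hrr' hM ι hι hε
  have hprod : 0 < ∏ k : Fin n, (r / r') ^ (k : ℕ) := Finset.prod_pos fun k _ => by positivity
  have hlog := Real.logb_le_logb_of_le one_lt_two (by positivity) hmain
  rw [Real.logb_mul (by positivity) (by positivity), Real.logb_mul (by positivity) (by positivity),
    logb_prod_pow, Real.logb_pow, Real.logb_pow, Real.logb_div hM.ne' (by positivity),
    Real.logb_mul (by norm_num) (by positivity), logb_sqrt (by positivity),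
    ← inv_div r' r, Real.logb_inv, ← hlamdef, Real.logb_self_eq_one one_lt_two] at hlog
  have hεL : Real.logb 2 ε = -L := by rw [hLdef, Real.logb_inv, neg_neg]
  rw [hεL] at hlog
  push_cast at hlog
  -- With t = λn - L in [0, λ], the loss t²/λ is at most t ≤ λn; the spare λn comes from n(n-1) in
  -- place of n².
  have hsq : L ^ 2 / lam ≤ 2 * n * L - lam * n ^ 2 + lam * n := by
    rw [div_le_iff₀ hlam]
    nlinarith [mul_nonneg (sub_nonneg.2 hn_ge) (sub_nonneg.2 hn_lt'),
      mul_nonneg hlam.le (sub_nonneg.2 hn_ge), hL]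
  have hfin := nat_mul_logb_le hn hnm (2 - 2 * Real.logb 2 M)
  rw [metricEntropy]
  linarith

/-! ### Asymptotics of the error term -/

/-- Factoring L out of L/λ + D splits its logarithm into log L plus a bounded term, so D and K
disappear in the limit. -/
theorem tendsto_ratio {lam : ℝ} (hlam : 0 < lam) (D K : ℝ) :
    Tendsto (fun L : ℝ => ((L / lam + D) * Real.logb 2 (L / lam + D) + K * (L / lam + D)) /
      (L / lam * Real.logb 2 L)) atTop (𝓝 1) := by
  have hlog : Tendsto (Real.logb 2) atTop atTop := Real.tendsto_logb_atTop one_lt_two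
  have h1 : Tendsto (fun L : ℝ => 1 + D * lam * L⁻¹) atTop (𝓝 1) := by
    simpa using (tendsto_inv_atTop_zero.const_mul (D * lam)).const_add 1
  have h2 : Tendsto (fun L : ℝ => Real.logb 2 (lam⁻¹ + D * L⁻¹)) atTop
      (𝓝 (Real.logb 2 lam⁻¹)) := by
    have h : Tendsto (fun L : ℝ => lam⁻¹ + D * L⁻¹) atTop (𝓝 lam⁻¹) := by
      simpa using (tendsto_inv_atTop_zero.const_mul D).const_add lam⁻¹
    exact (Real.continuousAt_logb (inv_ne_zero hlam.ne')).tendsto.comp h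
  have h3 := (h2.add_const K).div_atTop hlog
  have h4 := h1.mul (h3.const_add 1)
  rw [add_zero, mul_one] at h4
  have hpos : ∀ᶠ L : ℝ in atTop, 0 < L / lam + D :=
    (tendsto_atTop_add_const_right _ D (tendsto_id.atTop_div_const hlam)).eventually_gt_atTop 0
  refine h4.congr' ?_
  filter_upwards [eventually_gt_atTop 0, hlog.eventually_gt_atTop 0, hpos] with L hL hlogL hm
  have h5 : L / lam + D = L * (lam⁻¹ + D * L⁻¹) := by field_simp
  have h6 : 0 < lam⁻¹ + D * L⁻¹ := by
    rw [h5] at hm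
    exact pos_of_mul_pos_right hm hL.le
  have h7 : Real.logb 2 (L / lam + D) = Real.logb 2 L + Real.logb 2 (lam⁻¹ + D * L⁻¹) := by
    rw [h5, Real.logb_mul hL.ne' h6.ne']
  rw [h7]
  field_simp
  ring

/-- A function asymptotically bounded by `1` is a function bounded by `1` plus an error. -/
theorem exists_clamp_of_abs_le {α : Type*} {l : Filter α} {R h : α → ℝ} (hh : Tendsto h l (𝓝 1))
    (hR : ∀ᶠ x in l, |R x| ≤ h x) :
    ∃ γ ω : α → ℝ, (∀ x, |γ x| ≤ 1) ∧ Tendsto ω l (𝓝 0) ∧ ∀ x, R x = γ x + ω x := by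
  -- γ is R truncated to [-1, 1]; the remainder ω is eventually at most |h - 1| in absolute value.
  refine ⟨fun x => max (-1) (min 1 (R x)), fun x => R x - max (-1) (min 1 (R x)),
    fun x => ?_, ?_, fun x => by ring⟩
  · exact abs_le.2 ⟨le_max_left _ _, max_le (by norm_num) (min_le_left _ _)⟩
  · have h0 : Tendsto (fun x => |h x - 1|) l (𝓝 0) := by
      simpa using (hh.sub_const 1).abs
    refine squeeze_zero_norm' ?_ h0
    filter_upwards [hR] with x hx
    rw [abs_le] at hx
    rw [Real.norm_eq_abs]
    have h1 := le_abs_self (h x - 1)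
    have h2 := abs_nonneg (h x - 1)
    rw [abs_le]
    rcases le_total (R x) (-1) with h3 | h3
    · rw [min_eq_right (by linarith), max_eq_left h3]
      constructor <;> linarith
    · rcases le_total (R x) 1 with h4 | h4
      · rw [min_eq_right h4, max_eq_right h3]
        constructor <;> linarith
      · rw [min_eq_left h4, max_eq_right (by norm_num)]
        constructor <;> linarith

theorem tendsto_logb_inv_nhdsGT_zero :
    Tendsto (fun ε : ℝ => Real.logb 2 ε⁻¹) (𝓝[>] 0) atTop :=
  (Real.tendsto_logb_atTop one_lt_two).comp tendsto_inv_nhdsGT_zero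

/-- The metric space `X` is the ambient space from which the centres of the coverings are taken:
any metric space that contains the class `𝒜(r'; M)`, with the metric `d_r`, isometrically. -/
theorem mainTheorem6 (r r' M : ℝ) (hr : 0 < r) (hrr' : r < r') (hM : 0 < M)
    {X : Type*} [MetricSpace X] (ι : analyticBounded r' M → X)
    (hι : ∀ f g : analyticBounded r' M, dist (ι f) (ι g) = diskDist r f g) :
    (∀ ε : ℝ, 0 < ε → coveringNum ε (range ι) ≠ ⊤) ∧
    ∃ γ ω : ℝ → ℝ,
      (∀ ε : ℝ, 0 < ε → |γ ε| ≤ 1) ∧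
      Tendsto ω (𝓝[>] 0) (𝓝 0) ∧
      ∀ᶠ ε in 𝓝[>] (0 : ℝ),
        metricEntropy ε (range ι) =
          Real.logb 2 ε⁻¹ ^ 2 / Real.logb 2 (r' / r) +
            Real.logb 2 ε⁻¹ / Real.logb 2 (r' / r) * Real.logb 2 (Real.logb 2 ε⁻¹) *
              (γ ε + ω ε) := by
  have hfin : ∀ ε : ℝ, 0 < ε → coveringNum ε (range ι) ≠ ⊤ := fun ε hε =>
    coveringNum_ne_top hr hrr' hM ι hι hε
  obtain ⟨D, K₁, hD, hK₁, hup⟩ := metricEntropy_le hr hrr' hM ι hι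
  obtain ⟨K₂, hK₂, hlow⟩ := le_metricEntropy hr hrr' hM ι hι
  have hlam := logb_ratio_pos hr hrr'
  set lam := Real.logb 2 (r' / r)
  have hL := tendsto_logb_inv_nhdsGT_zero
  have hloglog := (Real.tendsto_logb_atTop one_lt_two).comp hL
  -- The value m = L/λ + D + 1 is admissible in both entropy bounds, and K₁ + K₂ dominates both
  -- linear terms, so a single h bounds the normalized error from either side.
  obtain ⟨γ, ω, hγ, hω, hsplit⟩ := exists_clamp_of_abs_le (R := fun ε =>
    (metricEntropy ε (range ι) - Real.logb 2 ε⁻¹ ^ 2 / lam) /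
      (Real.logb 2 ε⁻¹ / lam * Real.logb 2 (Real.logb 2 ε⁻¹)))
    ((tendsto_ratio hlam (D + 1) (K₁ + K₂)).comp hL) (by
      filter_upwards [hL.eventually_ge_atTop D, hL.eventually_gt_atTop 0,
        hloglog.eventually_gt_atTop 0, self_mem_nhdsWithin] with ε h1 h2 h3 hε
      rw [Function.comp_apply] at h3
      have hε : 0 < ε := hε
      have hm : 0 < Real.logb 2 ε⁻¹ / lam + (D + 1) := by positivity
      have hu := hup ε hε h1 (Real.logb 2 ε⁻¹ / lam + (D + 1)) (by linarith)
      have hl := hlow ε hε h2 (Real.logb 2 ε⁻¹ / lam + (D + 1)) (by linarith)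
      have := mul_nonneg hK₁ hm.le
      have := mul_nonneg hK₂ hm.le
      have hden : 0 < Real.logb 2 ε⁻¹ / lam * Real.logb 2 (Real.logb 2 ε⁻¹) := by positivity
      rw [abs_div, abs_of_pos hden, Function.comp_apply]
      gcongr
      rw [abs_le]
      constructor <;> linarith)
  refine ⟨hfin, γ, ω, fun ε _ => hγ ε, hω, ?_⟩
  filter_upwards [hL.eventually_gt_atTop 0, hloglog.eventually_gt_atTop 0] with ε h2 h3
  rw [Function.comp_apply] at h3
  have hden : Real.logb 2 ε⁻¹ / lam * Real.logb 2 (Real.logb 2 ε⁻¹) ≠ 0 := by positivity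
  rw [← hsplit ε, mul_div_cancel₀ _ hden]
  ring
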